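/- Let $q$ be a power of a prime $p$, let $\mathbb{F}_{q^2}$ be the field with $q^2$ elements, let $n\ge 1$, and write $n=\overline{n}p^{\nu}$ with $p\nmid\overline{n}$ and $\nu\ge 0$. Let $\lambda\in\mathbb{F}_{q^2}^{*}$ have multiplicative order $r$ with $r\mid q+1$. A linear code $C\subseteq\mathbb{F}_{q^2}^n$ is called $\lambda$-constacyclic if $(\lambda c_{n-1},c_0,\dots,c_{n-2})\in C$ for all $(c_0,\dots,c_{n-1})\in C$. Its Hermitian hull is $\mathrm{Hull}_H(C)=C\cap C^{\perp_H}$, where $C^{\perp_H}=\{u\in\mathbb{F}_{q^2}^n : \sum_{i} u_iv_i^q=0 \text{ for all } v\in C\}$. Let $\mathcal{C}$ be the set of all $\lambda$-constacyclic codes of length $n$ over $\mathbb{F}_{q^2}$ and let $$E_H(n,\lambda,q^2)=\frac{1}{|\mathcal{C}|}\sum_{C\in\mathcal{C}}\dim\mathrm{Hull}_H(C)$$ be the average dimension of the Hermitian hull. For $f=\sum_{i=0}^{k}a_ix^i$ of degree $k$ with $a_0\ne 0$ put $f^{\dagger}=a_0^{-q}\sum_{i=0}^{k}a_i^qx^{k-i}$.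 Let $\Lambda\in\mathbb{F}_{q^2}$ be the (unique) element with $\Lambda^{p^{\nu}}=\lambda$, and let $B$ be the sum of the degrees of the monic irreducible factors $g$ of $x^{\overline{n}}-\Lambda$ over $\mathbb{F}_{q^2}$ with $g^{\dagger}=g$. Let $M_q$ be the set of integers $\ell\ge 1$ that divide $q^i+1$ for some odd positive integer $i$. Let $\beta(j)$ denote the exponent of $2$ in the prime factorization of a positive integer $j$, and let $\gamma=\beta(q+1)$. Then: 0. $E_H(n,\lambda,q^2)=n\left(\frac13-\frac{1}{6(p^{\nu}+1)}\right)$ if and only if $B=0$. 1. If $r$ is even, then $E_H(n,\lambda,q^2)=n\left(\frac13-\frac{1}{6(p^{\nu}+1)}\right)$ if and only if $\beta(\overline{n})+\beta(r)>\gamma$ or $r\notin M_q$. 2. If $r$ is odd, then $E_H(n,\lambda,q^2)=n\left(\frac13-\frac{1}{6(p^{\nu}+1)}\right)$ if and only if $r\notin M_q$. -/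

import Mathlib

open Polynomial

noncomputable section

namespace HermitianHull

variable {F : Type*} [Field F]

/-- The Hermitian dual of a linear code `C`: all `u` with `∑ i, u i * (v i) ^ q = 0` for every
`v ∈ C`. -/
def hermitianDual (q : ℕ) {n : ℕ} (C : Submodule F (Fin n → F)) : Submodule F (Fin n → F) where
  carrier := {u | ∀ v ∈ C, ∑ i, u i * v i ^ q = 0}
  zero_mem' := by
    intro v _
    simp
  add_mem' := by
    intro a b ha hb v hv
    simp only [Pi.add_apply, add_mul, Finset.sum_add_distrib, ha v hv, hb v hv, add_zero]
  smul_mem' := by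
    intro c a ha v hv
    simp only [Pi.smul_apply, smul_eq_mul, mul_assoc, ← Finset.mul_sum, ha v hv, mul_zero]

/-- The Hermitian hull of a linear code. -/
def hermitianHull (q : ℕ) {n : ℕ} (C : Submodule F (Fin n → F)) : Submodule F (Fin n → F) :=
  C ⊓ hermitianDual q C

/-- The constacyclic shift `(c₀, …, c_{n-1}) ↦ (lam * c_{n-1}, c₀, …, c_{n-2})`. -/
def constaShift (lam : F) {n : ℕ} (c : Fin n → F) : Fin n → F := fun i =>
  if i.val = 0 then lam * c ⟨n - 1, by have := i.isLt; omega⟩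
  else c ⟨i.val - 1, by have := i.isLt; omega⟩

/-- The set of all `lam`-constacyclic codes of length `n` over `F`. -/
def constacyclicCodes (n : ℕ) (lam : F) : Set (Submodule F (Fin n → F)) :=
  {C | ∀ c ∈ C, constaShift lam c ∈ C}

/-- The average dimension of the Hermitian hull of `lam`-constacyclic codes of length `n`
over `F` (where `F` has `q ^ 2` elements). -/
def avgHullDim [Finite F] (q n : ℕ) (lam : F) : ℝ :=
  ∑ C ∈ (Set.toFinite (constacyclicCodes n lam)).toFinset,
    (Module.finrank F (hermitianHull q C) : ℝ) / ((constacyclicCodes n lam).ncard : ℝ)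

/-- The conjugate-reciprocal polynomial
`a₀^{-q} ∑_{i ≤ k} a_i^q x^{k-i}` of `f = a₀ + a₁ x + ⋯ + a_k x^k`, where `k = deg f`
and `a₀ ≠ 0`. -/
def conjReciprocal (q : ℕ) (f : F[X]) : F[X] :=
  C ((f.coeff 0 ^ q)⁻¹) *
    ∑ i ∈ Finset.range (f.natDegree + 1), C (f.coeff i ^ q) * X ^ (f.natDegree - i)

open Classical in
/-- The sum of the degrees of the self-conjugate-reciprocal monic irreducible factors of
`x ^ m - Lam`. -/
def selfConjDegree (q m : ℕ) (Lam : F) : ℕ :=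
  (((UniqueFactorizationMonoid.normalizedFactors (X ^ m - C Lam : F[X])).filter
    (fun g => conjReciprocal q g = g)).map natDegree).sum

/-- The set `M_q` of the positive integers dividing `q ^ i + 1` for some odd positive `i`. -/
def oddGood (q : ℕ) : Set ℕ :=
  {l | 1 ≤ l ∧ ∃ i : ℕ, Odd i ∧ l ∣ q ^ i + 1}

end HermitianHull

end

/-! Write N = x^n - λ and P = p^ν. Then N = (x^nbar - Λ)^P, and the base is separable, so N = ∏
f_i^P with distinct monic irreducible f_i. The constacyclic codes are the ideals generated by ∏
f_i^{a_i}, 0 ≤ a_i ≤ P (`bijOn_polyCode_prod_pow`). Since λ^(q+1) = 1, the map † permutes the f_i by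
an involution τ, and u lies in the Hermitian dual of the code of g exactly when N ∣ u g†
(`mem_hermitianDual_polyCode`). Hence the hull has dimension ∑ min(P - a_i, a_{τ i}) deg f_i
(`finrank_hermitianHull_polyCode`).

On averaging over all exponent vectors, an index with τ i ≠ i sees two independent uniform exponents
and contributes deg f_i · P(2P+1)/(6(P+1)); these values sum to the stated bound if they occur at
every i. An index with τ i = i sees a single exponent, and its mean is at most P²/(4(P+1)), strictly
smaller. So the bound is attained iff no f_i is fixed by † (`avgHullDim_eq_iff`).

If δ is a root of f, then δ^(-q) is a root of f†, so f† = f means that δ^(-q) = δ^(q^(2j)) for some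
j. Comparing the power of 2 in the order of δ with that in q^(2j) + q, and constructing a suitable δ
in the other direction, turns the existence of a fixed factor into a 2-adic condition
(`exists_conjReciprocal_eq_self_iff`). -/

noncomputable section

namespace HermitianHull

/-! ### Averages of functions of one or two coordinates, and sums of minima. -/

section Counting

variable {ι K : Type*} [Fintype ι] [DecidableEq ι] [Fintype K]

theorem sum_pi_apply (i : ι) (φ : K → ℝ) :
    (∑ a : ι → K, φ (a i)) * (Fintype.card K : ℝ) =
      (Fintype.card K : ℝ) ^ Fintype.card ι * ∑ x, φ x := by
  have h : ∑ a : ι → K, φ (a i) = ∑ z : K × ({j // j ≠ i} → K), φ z.1 :=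
    Fintype.sum_equiv (Equiv.funSplitAt i K) _ _ fun a => rfl
  have hc : Fintype.card ι = Fintype.card {j // j ≠ i} + 1 := by
    rw [← Fintype.card_option, Fintype.card_congr (Equiv.optionSubtypeNe i)]
  rw [h, Fintype.sum_prod_type]
  simp only [Finset.sum_const, Finset.card_univ, Fintype.card_fun, nsmul_eq_mul, Nat.cast_pow]
  rw [← Finset.mul_sum, hc, pow_succ]
  ring

theorem sum_pi_apply_apply {i j : ι} (hij : i ≠ j) (φ : K → K → ℝ) :
    (∑ a : ι → K, φ (a i) (a j)) * (Fintype.card K : ℝ) ^ 2 =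
      (Fintype.card K : ℝ) ^ Fintype.card ι * ∑ x, ∑ y, φ x y := by
  have h : ∑ a : ι → K, φ (a i) (a j) =
      ∑ z : K × ({j // j ≠ i} → K), φ z.1 (z.2 ⟨j, hij.symm⟩) :=
    Fintype.sum_equiv (Equiv.funSplitAt i K) _ _ fun a => rfl
  have hc : Fintype.card ι = Fintype.card {j // j ≠ i} + 1 := by
    rw [← Fintype.card_option, Fintype.card_congr (Equiv.optionSubtypeNe i)]
  rw [h, Fintype.sum_prod_type, pow_two, ← mul_assoc, Finset.sum_mul]
  simp only [sum_pi_apply (⟨j, hij.symm⟩ : {j // j ≠ i})]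
  rw [← Finset.mul_sum, hc, pow_succ]
  ring

theorem six_mul_sum_min (P : ℕ) :
    6 * ∑ x ∈ Finset.range (P + 1), ∑ y ∈ Finset.range (P + 1), min x y =
      P * (P + 1) * (2 * P + 1) := by
  induction P with
  | zero => simp
  | succ P ih =>
    have h1 : ∀ x ∈ Finset.range (P + 1), min x (P + 1) = x := fun x hx => by
      have := Finset.mem_range.1 hx; omega
    have h2 : ∀ x ∈ Finset.range (P + 1), min (P + 1) x = x := fun x hx => by
      have := Finset.mem_range.1 hx; omega
    have h3 := Finset.sum_range_id_mul_two (P + 1)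
    rw [Finset.sum_range_succ]
    simp only [Finset.sum_range_succ _ (P + 1), Finset.sum_add_distrib]
    rw [Finset.sum_congr rfl h1, Finset.sum_congr rfl h2, min_self]
    simp only [Nat.add_sub_cancel] at h3
    nlinarith

/-- Going from P to P + 2 adds two zero end terms and raises each of the P + 1 inner terms by one.
-/
theorem four_mul_sum_min_sub_le (P : ℕ) :
    4 * ∑ x ∈ Finset.range (P + 1), min (P - x) x ≤ P ^ 2 := by
  induction P using Nat.twoStepInduction with
  | zero => simp
  | one => simp [Finset.sum_range_succ]
  | more P ih _ =>
    rw [Finset.sum_range_succ, Finset.sum_range_succ']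
    have h : ∀ x ∈ Finset.range (P + 1), min (P + 2 - (x + 1)) (x + 1) = min (P - x) x + 1 :=
      fun x hx => by have := Finset.mem_range.1 hx; omega
    rw [Finset.sum_congr rfl h, Finset.sum_add_distrib]
    simp
    nlinarith

theorem sum_fin_min_sub (P : ℕ) :
    ∑ x : Fin (P + 1), ∑ y : Fin (P + 1), ((min (P - (x : ℕ)) (y : ℕ) : ℕ) : ℝ) =
      P * (P + 1) * (2 * P + 1) / 6 := by
  have h := six_mul_sum_min P
  -- The substitution x ↦ P - x turns min(x, y) into min(P - x, y).
  rw [← Finset.sum_range_reflect] at h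
  simp only [Nat.add_sub_cancel] at h
  rw [Finset.sum_range] at h
  simp only [Finset.sum_range] at h
  have h' := congrArg (Nat.cast : ℕ → ℝ) h
  push_cast at h' ⊢
  linarith

theorem sum_fin_min_sub_self_le (P : ℕ) :
    ∑ x : Fin (P + 1), ((min (P - (x : ℕ)) (x : ℕ) : ℕ) : ℝ) ≤ (P : ℝ) ^ 2 / 4 := by
  have h := four_mul_sum_min_sub_le P
  rw [Finset.sum_range] at h
  have h' : ((4 * ∑ x : Fin (P + 1), min (P - (x : ℕ)) (x : ℕ) : ℕ) : ℝ) ≤ ((P ^ 2 : ℕ) : ℝ) :=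
    Nat.cast_le.2 h
  push_cast at h' ⊢
  linarith

end Counting

/-! ### Arithmetic of q^i + 1 and of orders of roots. -/

section Divisibility

/-- The witness i is the odd part of n. One compares valuations prime by prime: at an odd prime
dividing r, lifting the exponent gives q^i + 1 the valuation of q + 1 plus that of n; at 2 this is
`h2`; at primes not dividing r the gcd alone counts. -/
theorem exists_odd_mul_gcd_dvd_pow_add_one {q r n : ℕ} (hn : n ≠ 0) (hr : r ∣ q + 1)
    (h2 : Even r → padicValNat 2 n + padicValNat 2 r ≤ padicValNat 2 (q + 1)) :
    ∃ i, Odd i ∧ r * n.gcd (q ^ i + 1) ∣ q ^ i + 1 := by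
  obtain ⟨b, o, ho, rfl⟩ := Nat.exists_eq_two_pow_mul_odd hn
  refine ⟨o, ho, ?_⟩
  have hr0 : r ≠ 0 := by rintro rfl; simp at hr
  have hqo : q + 1 ∣ q ^ o + 1 := by simpa using ho.nat_add_dvd_pow_add_pow q 1
  have hg0 : (2 ^ b * o).gcd (q ^ o + 1) ≠ 0 := Nat.gcd_ne_zero_left hn
  rw [← Nat.factorization_prime_le_iff_dvd (mul_ne_zero hr0 hg0) (by omega)]
  intro l hl
  have : Fact l.Prime := ⟨hl⟩
  rw [Nat.factorization_mul hr0 hg0, Nat.factorization_gcd hn (by omega)]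
  simp only [Finsupp.add_apply, Finsupp.inf_apply]
  have hrq : r.factorization l ≤ (q + 1).factorization l :=
    (Nat.factorization_le_iff_dvd hr0 (by omega)).2 hr l
  have hqo' : (q + 1).factorization l ≤ (q ^ o + 1).factorization l :=
    (Nat.factorization_le_iff_dvd (by omega) (by omega)).2 hqo l
  by_cases hlr : l ∣ r
  · have hlq : l ∣ q + 1 := hlr.trans hr
    rcases hl.eq_two_or_odd' with rfl | hlo
    · have := h2 (even_iff_two_dvd.2 hlr)
      rw [← Nat.factorization_def _ hl, ← Nat.factorization_def _ hl,
        ← Nat.factorization_def _ hl] at this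
      have h3 := min_le_left ((2 ^ b * o).factorization 2) ((q ^ o + 1).factorization 2)
      omega
    · have hlq' : ¬ l ∣ q := fun h => hl.one_lt.ne' (Nat.dvd_one.1 ((Nat.dvd_add_right h).1 hlq))
      have h4 := padicValNat.pow_add_pow hlo (x := q) (y := 1) hlq hlq' ho
      rw [one_pow, ← Nat.factorization_def _ hl, ← Nat.factorization_def _ hl,
        ← Nat.factorization_def _ hl] at h4
      have h5 : (2 ^ b * o).factorization l = o.factorization l := by
        rw [Nat.factorization_mul (by positivity) ho.pos.ne', Finsupp.add_apply,
          Nat.factorization_eq_zero_of_not_dvd (n := 2 ^ b), zero_add]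
        intro h
        have h6 := (Nat.prime_dvd_prime_iff_eq hl Nat.prime_two).1 (hl.dvd_of_dvd_pow h)
        subst h6
        exact absurd hlo (by decide)
      have h7 := min_le_left ((2 ^ b * o).factorization l) ((q ^ o + 1).factorization l)
      omega
  · rw [Nat.factorization_eq_zero_of_not_dvd hlr, zero_add]
    exact min_le_right _ _

/-- The `2`-part of the order of an `n`-th root of an element of even order `r`. -/
theorem two_pow_dvd_orderOf_of_pow {G : Type*} [Monoid G] {x : G} {n r : ℕ} (hn : n ≠ 0)
    (hr : orderOf (x ^ n) = r) (hr0 : r ≠ 0) (h2 : Even r) :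
    2 ^ (padicValNat 2 n + padicValNat 2 r) ∣ orderOf x := by
  rw [orderOf_pow' _ hn] at hr
  have hd0 : orderOf x ≠ 0 := by
    intro h; rw [h, Nat.zero_div] at hr; exact hr0 hr.symm
  have hg0 : (orderOf x).gcd n ≠ 0 := Nat.gcd_ne_zero_right hn
  have hd : orderOf x = r * (orderOf x).gcd n := by
    rw [← hr, Nat.div_mul_cancel (Nat.gcd_dvd_left _ _)]
  have h := congrArg (fun k => k.factorization 2) hd
  simp only [Nat.factorization_mul hr0 hg0, Nat.factorization_gcd hd0 hn, Finsupp.add_apply,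
    Finsupp.inf_apply] at h
  have hpos := Nat.prime_two.factorization_pos_of_dvd hr0 h2.two_dvd
  rw [Nat.prime_two.pow_dvd_iff_le_factorization hd0, ← Nat.factorization_def _ Nat.prime_two,
    ← Nat.factorization_def _ Nat.prime_two]
  -- Here v(d) = v(r) + min(v(d), v(n)) with d the order of x; as v(r) > 0, the minimum must be
  -- v(n).
  omega

/-- The sum is congruent to q + 1 modulo q² - 1 = (q + 1)(q - 1), and the even factor q - 1 makes
this modulus divisible by 2^(γ+1). -/
theorem not_two_pow_dvd_pow_add {q γ : ℕ} (hq : Odd q) (hγ : 2 ^ γ ∣ q + 1)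
    (hγ' : ¬ 2 ^ (γ + 1) ∣ q + 1) (j : ℕ) : ¬ 2 ^ (γ + 1) ∣ (q ^ 2) ^ j + q := by
  intro h
  apply hγ'
  have h1 : q ^ 2 - 1 ∣ (q ^ 2) ^ j - 1 := by simpa using Nat.sub_dvd_pow_sub_pow (q ^ 2) 1 j
  have hq1 : 1 ≤ q := hq.pos
  have h2 : 2 ^ (γ + 1) ∣ q ^ 2 - 1 := by
    have : q ^ 2 - 1 = (q + 1) * (q - 1) := by simpa using Nat.sq_sub_sq q 1
    rw [this, pow_succ]
    exact mul_dvd_mul hγ (Nat.Odd.sub_odd hq odd_one).two_dvd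
  have h3 : (q ^ 2) ^ j + q = ((q ^ 2) ^ j - 1) + (q + 1) := by
    have : 1 ≤ (q ^ 2) ^ j := Nat.one_le_pow _ _ (by positivity)
    omega
  rw [h3] at h
  exact (Nat.dvd_add_right (h2.trans h1)).1 h

end Divisibility

/-! ### The conjugate-reciprocal as a multiplicative, degree-preserving involution. -/

section ConjReciprocal

variable {F : Type*} [Field F] {q : ℕ} {σ : F →+* F}

theorem conjReciprocal_eq (hσ : ∀ x, σ x = x ^ q) (f : F[X]) :
    conjReciprocal q f = C (σ (f.coeff 0))⁻¹ * (f.map σ).reverse := by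
  rw [conjReciprocal, hσ, reverse, natDegree_map]
  congr 1
  conv_rhs => rw [(f.map σ).as_sum_range' (f.natDegree + 1) (by rw [natDegree_map]; omega)]
  have hsum := map_sum (AddMonoidHom.mk' (reflect f.natDegree)
    (fun a b : F[X] => reflect_add a b f.natDegree))
    (fun i => monomial i ((f.map σ).coeff i)) (Finset.range (f.natDegree + 1))
  simp only [AddMonoidHom.mk'_apply] at hsum
  rw [hsum]
  refine Finset.sum_congr rfl fun i hi => ?_
  simp only [coeff_map, ← C_mul_X_pow_eq_monomial, reflect_C_mul_X_pow, hσ]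
  rw [revAt_le (by have := Finset.mem_range.1 hi; omega)]

theorem conjReciprocal_one (q : ℕ) : conjReciprocal q (1 : F[X]) = 1 := by
  simp [conjReciprocal]

theorem conjReciprocal_mul (hσ : ∀ x, σ x = x ^ q) (f g : F[X]) :
    conjReciprocal q (f * g) = conjReciprocal q f * conjReciprocal q g := by
  simp only [conjReciprocal_eq hσ, Polynomial.map_mul, reverse_mul_of_domain, mul_coeff_zero,
    map_mul, mul_inv]
  ring

/-- The conjugate-reciprocal as a multiplicative map. -/
def conjReciprocalHom (hσ : ∀ x, σ x = x ^ q) : F[X] →* F[X] where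
  toFun := conjReciprocal q
  map_one' := conjReciprocal_one q
  map_mul' := conjReciprocal_mul hσ

theorem conjReciprocal_prod_pow (hσ : ∀ x, σ x = x ^ q) {ι : Type*} (s : Finset ι)
    (f : ι → F[X]) (a : ι → ℕ) :
    conjReciprocal q (∏ i ∈ s, f i ^ a i) = ∏ i ∈ s, conjReciprocal q (f i) ^ a i := by
  refine (map_prod (conjReciprocalHom hσ) (fun i => f i ^ a i) s).trans ?_
  exact Finset.prod_congr rfl fun i _ => map_pow (conjReciprocalHom hσ) _ _

theorem coeff_zero_conjReciprocal (hσ : ∀ x, σ x = x ^ q) (f : F[X]) :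
    (conjReciprocal q f).coeff 0 = (σ (f.coeff 0))⁻¹ * σ f.leadingCoeff := by
  rw [conjReciprocal_eq hσ, coeff_C_mul, coeff_zero_reverse, leadingCoeff_map]

theorem coeff_zero_conjReciprocal_ne_zero (hσ : ∀ x, σ x = x ^ q) {f : F[X]}
    (h0 : f.coeff 0 ≠ 0) : (conjReciprocal q f).coeff 0 ≠ 0 := by
  have hf : f ≠ 0 := by rintro rfl; simp at h0
  rw [coeff_zero_conjReciprocal hσ]
  simp [h0, hf]

theorem natTrailingDegree_map_eq_zero {f : F[X]} (h0 : f.coeff 0 ≠ 0) :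
    (f.map σ).natTrailingDegree = 0 :=
  natTrailingDegree_eq_zero.2 (Or.inr (by simpa using h0))

theorem natDegree_conjReciprocal (hσ : ∀ x, σ x = x ^ q) {f : F[X]} (h0 : f.coeff 0 ≠ 0) :
    (conjReciprocal q f).natDegree = f.natDegree := by
  rw [conjReciprocal_eq hσ, natDegree_C_mul (by simpa using h0), reverse_natDegree,
    natTrailingDegree_map_eq_zero h0, natDegree_map, Nat.sub_zero]

theorem monic_conjReciprocal (hσ : ∀ x, σ x = x ^ q) {f : F[X]} (h0 : f.coeff 0 ≠ 0) :
    (conjReciprocal q f).Monic := by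
  rw [Monic, conjReciprocal_eq hσ, leadingCoeff_mul, leadingCoeff_C, reverse_leadingCoeff,
    trailingCoeff, natTrailingDegree_map_eq_zero h0, coeff_map]
  exact inv_mul_cancel₀ (by simpa using h0)

theorem conjReciprocal_conjReciprocal (hσ : ∀ x, σ x = x ^ q) (hσσ : ∀ x, σ (σ x) = x)
    {f : F[X]} (hf : f.Monic) (h0 : f.coeff 0 ≠ 0) :
    conjReciprocal q (conjReciprocal q f) = f := by
  have h : (conjReciprocal q f).coeff 0 = (σ (f.coeff 0))⁻¹ := by
    rw [coeff_zero_conjReciprocal hσ, hf, map_one, mul_one]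
  have hid : σ.comp σ = RingHom.id F := RingHom.ext hσσ
  rw [conjReciprocal_eq hσ (conjReciprocal q f), h, map_inv₀ σ, inv_inv, hσσ, reverse, natDegree_map,
    natDegree_conjReciprocal hσ h0, conjReciprocal_eq hσ, Polynomial.map_mul, map_C, reflect_C_mul,
    map_inv₀ σ, hσσ, ← mul_assoc, ← C_mul, mul_inv_cancel₀ h0, C_1, one_mul, reverse, natDegree_map,
    ← reflect_map, reflect_reflect, Polynomial.map_map, hid, Polynomial.map_id]

/-- Applying the involution to a factorization of f† gives one of f, and non-units stay non-units
because the degree is preserved when the constant term is nonzero. -/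
theorem irreducible_conjReciprocal (hσ : ∀ x, σ x = x ^ q) (hσσ : ∀ x, σ (σ x) = x)
    {f : F[X]} (hf : f.Monic) (h0 : f.coeff 0 ≠ 0) (hirr : Irreducible f) :
    Irreducible (conjReciprocal q f) := by
  have key : ∀ {u : F[X]}, u.coeff 0 ≠ 0 → IsUnit (conjReciprocal q u) → IsUnit u := by
    intro u hu h
    have hu0 : u ≠ 0 := by rintro rfl; simp at hu
    have h' := h.ne_zero
    rw [isUnit_iff_degree_eq_zero, degree_eq_natDegree h', natDegree_conjReciprocal hσ hu] at h
    rwa [isUnit_iff_degree_eq_zero, degree_eq_natDegree hu0]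
  refine ⟨fun h => hirr.not_isUnit (key h0 h), fun u v huv => ?_⟩
  have hc := coeff_zero_conjReciprocal_ne_zero hσ h0
  rw [huv, mul_coeff_zero] at hc
  have h := conjReciprocal_conjReciprocal hσ hσσ hf h0
  rw [huv, conjReciprocal_mul hσ] at h
  rcases hirr.isUnit_or_isUnit h.symm with h1 | h1
  · exact Or.inl (key (left_ne_zero_of_mul hc) h1)
  · exact Or.inr (key (right_ne_zero_of_mul hc) h1)

theorem conjReciprocal_X_pow_sub_C (hσ : ∀ x, σ x = x ^ q) {m : ℕ} (hm : m ≠ 0) {c : F}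
    (hc : c ^ (q + 1) = 1) : conjReciprocal q (X ^ m - C c) = X ^ m - C c := by
  have hc0 : c ≠ 0 := by rintro rfl; simp at hc
  have hcσ : (σ c)⁻¹ = c := by
    rw [hσ, inv_eq_of_mul_eq_one_left]
    rw [← pow_succ', hc]
  rw [conjReciprocal_eq hσ, reverse, natDegree_map, natDegree_X_pow_sub_C]
  have h0 : (X ^ m - C c : F[X]).coeff 0 = -c := by simp [hm.symm]
  rw [h0, Polynomial.map_sub, Polynomial.map_pow, map_X, map_C, reflect_sub, reflect_monomial,
    reflect_C, revAt_le le_rfl, Nat.sub_self, pow_zero, map_neg, inv_neg, hcσ, mul_sub, ← mul_assoc,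
    ← C_mul]
  have h1 : -c * σ c = -1 := by
    rw [hσ, neg_mul, ← pow_succ', hc]
  rw [h1]
  simp
  ring

theorem coeff_zero_ne_zero_of_dvd_X_pow_sub_C {f : F[X]} {n : ℕ} (hn : n ≠ 0) {c : F}
    (hc : c ≠ 0) (h : f ∣ X ^ n - C c) : f.coeff 0 ≠ 0 := by
  obtain ⟨g, hg⟩ := h
  have := congrArg (fun p => coeff p 0) hg
  intro h0
  simp [mul_coeff_zero, h0, hn.symm, hc] at this

/-- The q-power Frobenius of K extends σ, so δ^q is a root of the conjugated polynomial; reversal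
inverts roots. -/
theorem aeval_conjReciprocal_eq_zero {p m : ℕ} [Fact p.Prime] [CharP F p] (hq : q = p ^ m)
    (hσ : ∀ x, σ x = x ^ q) {K : Type*} [Field K] [Algebra F K] {f : F[X]} {δ : K} (hδ : δ ≠ 0)
    (h : aeval δ f = 0) : aeval ((δ ^ q)⁻¹) (conjReciprocal q f) = 0 := by
  have : CharP K p := charP_of_injective_algebraMap (algebraMap F K).injective p
  have : ExpChar K p := ExpChar.prime Fact.out
  let inv : Invertible (δ ^ q) := invertibleOfNonzero (pow_ne_zero q hδ)
  have h1 := eval₂_reverse_eq_zero_iff (algebraMap F K) (δ ^ q) (f.map σ)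
  rw [invOf_eq_inv] at h1
  rw [conjReciprocal_eq hσ, map_mul]
  refine mul_eq_zero_of_right _ (h1.2 ?_)
  have h2 := hom_eval₂ f (algebraMap F K) (iterateFrobenius K p m) δ
  rw [← aeval_def, h, map_zero, iterateFrobenius_def, ← hq] at h2
  rw [eval₂_map, h2]
  congr 1
  ext x
  simp [hσ, iterateFrobenius_def, ← hq]

end ConjReciprocal

/-! ### When x^n - c has a self-conjugate-reciprocal irreducible factor. -/

section Roots

variable {F : Type*} [Field F] [Finite F]

/-- An automorphism carries x to y; restricted to the finite field F(x), it is a power of Frobenius.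
-/
theorem exists_eq_pow_card_pow_of_root {f : F[X]} (hirr : Irreducible f) (hf : f.Monic)
    {x y : AlgebraicClosure F} (hx : aeval x f = 0) (hy : aeval y f = 0) :
    ∃ j, y = x ^ Nat.card F ^ j := by
  have := Fintype.ofFinite F
  have hxa : IsAlgebraic F x := ⟨f, hirr.ne_zero, hx⟩
  have hmin : f = minpoly F x := minpoly.eq_of_irreducible_of_monic hirr hx hf
  rw [hmin] at hy
  obtain ⟨φ, rfl⟩ := minpoly.exists_algEquiv_of_root' hxa hy
  let L := IntermediateField.adjoin F {x}
  have : FiniteDimensional F L := IntermediateField.adjoin.finiteDimensional hxa.isIntegral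
  have : Finite L := Module.finite_of_finite F
  have : Normal F L := inferInstance
  obtain ⟨j, hj⟩ := (FiniteField.bijective_frobeniusAlgEquivOfAlgebraic_pow F L).2
    (φ.restrictNormal L)
  refine ⟨j, ?_⟩
  have h := φ.restrictNormal_commutes L (IntermediateField.AdjoinSimple.gen F x)
  rw [← hj] at h
  simp only [AlgEquiv.coe_pow, FiniteField.coe_frobeniusAlgEquivOfAlgebraic, pow_iterate,
    map_pow, ← Nat.card_eq_fintype_card] at h
  exact h.symm

/-- The hypothesis forces z to be a power of ζ^gcd(n, N), and by Bézout ζ^gcd(n, N) is the n-th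
power of a power of ζ. -/
theorem exists_pow_eq_of_mul_gcd_dvd {K : Type*} [Field K] {N n r : ℕ} {ζ z : K} (hN : N ≠ 0)
    (hζ : IsPrimitiveRoot ζ N) (hr : r ≠ 0) (hz : z ^ r = 1) (h : r * n.gcd N ∣ N) :
    ∃ δ : K, δ ^ N = 1 ∧ δ ^ n = z := by
  have : NeZero N := ⟨hN⟩
  have hzN : z ^ N = 1 := by
    obtain ⟨k, hk⟩ := (dvd_mul_right r (n.gcd N)).trans h
    rw [hk, pow_mul, hz, one_pow]
  obtain ⟨s, -, rfl⟩ := hζ.eq_pow_of_pow_eq_one hzN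
  rw [← pow_mul, hζ.pow_eq_one_iff_dvd] at hz
  obtain ⟨t, rfl⟩ : n.gcd N ∣ s := by
    have := h.trans hz
    rw [mul_comm s r] at this
    exact Nat.dvd_of_mul_dvd_mul_left (Nat.pos_of_ne_zero hr) this
  have hζ0 : ζ ≠ 0 := hζ.ne_zero hN
  refine ⟨(ζ ^ n.gcdA N) ^ t, ?_, ?_⟩
  · rw [← pow_mul, mul_comm, pow_mul, ← zpow_natCast (ζ ^ n.gcdA N) N, ← zpow_mul, mul_comm,
      zpow_mul, zpow_natCast, hζ.pow_eq_one, one_zpow, one_pow]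
  · rw [← pow_mul, mul_comm, pow_mul, pow_mul]
    congr 1
    rw [← zpow_natCast ζ (n.gcd N), Nat.gcd_eq_gcd_ab, zpow_add₀ hζ0, zpow_mul, zpow_mul,
      zpow_natCast ζ N, hζ.pow_eq_one, one_zpow, mul_one, zpow_natCast, ← zpow_natCast,
      ← zpow_natCast, ← zpow_mul, ← zpow_mul, mul_comm]

variable {p q m : ℕ} [Fact p.Prime] [CharP F p] {σ : F →+* F}

theorem exists_conjReciprocal_eq_self_iff (hq : q = p ^ m) (hm : m ≠ 0) (hF : Nat.card F = q ^ 2)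
    (hσ : ∀ x, σ x = x ^ q) (hσσ : ∀ x, σ (σ x) = x) {n r γ : ℕ} (hn : n ≠ 0) {c : F}
    (hr : orderOf c = r) (hrq : r ∣ q + 1) (hγ : 2 ^ γ ∣ q + 1) (hγ' : ¬ 2 ^ (γ + 1) ∣ q + 1) :
    (∃ f : F[X], Irreducible f ∧ f.Monic ∧ f ∣ X ^ n - C c ∧ conjReciprocal q f = f) ↔
      (Even r → padicValNat 2 n + padicValNat 2 r ≤ γ) := by
  let K := AlgebraicClosure F
  have : CharP K p := charP_of_injective_algebraMap (algebraMap F K).injective p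
  have hr0 : r ≠ 0 := by rintro rfl; simp at hrq
  have hc0 : c ≠ 0 := by
    rintro rfl
    apply hr0
    rw [← hr, orderOf_eq_zero_iff']
    intro k hk
    simp [hk.ne']
  have hroot : ∀ {f : F[X]} {δ : K}, f ∣ X ^ n - C c → aeval δ f = 0 →
      δ ^ n = algebraMap F K c := by
    intro f δ hf h
    have := aeval_eq_zero_of_dvd_aeval_eq_zero hf h
    simpa [sub_eq_zero] using this
  have hne : ∀ {δ : K}, δ ^ n = algebraMap F K c → δ ≠ 0 := by
    rintro δ hδ rfl
    rw [zero_pow hn] at hδ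
    exact hc0 ((map_eq_zero (algebraMap F K)).1 hδ.symm)
  have hrK : orderOf (algebraMap F K c) = r := by
    rw [← hr]
    exact orderOf_injective (algebraMap F K).toMonoidHom (algebraMap F K).injective c
  constructor
  · rintro ⟨f, hirr, hmon, hdvd, hself⟩ heven
    by_contra! hlt
    obtain ⟨δ, hδ⟩ := IsAlgClosed.exists_aeval_eq_zero K f
      (by rw [degree_eq_natDegree hirr.ne_zero]; exact_mod_cast hirr.natDegree_pos.ne')
    have hδn := hroot hdvd hδ
    have hδ0 := hne hδn
    have h1 := aeval_conjReciprocal_eq_zero hq hσ hδ0 hδ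
    rw [hself] at h1
    obtain ⟨j, hj⟩ := exists_eq_pow_card_pow_of_root hirr hmon hδ h1
    have h2 : δ ^ ((q ^ 2) ^ j + q) = 1 := by
      rw [pow_add, ← hF, ← hj, inv_mul_cancel₀ (pow_ne_zero _ hδ0)]
    have hqodd : Odd q := by
      have : Even (q + 1) := even_iff_two_dvd.2 (heven.two_dvd.trans hrq)
      rw [Nat.even_add_one, Nat.not_even_iff_odd] at this
      exact this
    refine not_two_pow_dvd_pow_add hqodd hγ hγ' j ?_
    refine (pow_dvd_pow 2 hlt).trans ((two_pow_dvd_orderOf_of_pow hn ?_ hr0 heven).trans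
      (orderOf_dvd_of_pow_eq_one h2))
    rw [hδn, hrK]
  · intro h
    have hγv : γ ≤ padicValNat 2 (q + 1) := (padicValNat_dvd_iff_le (by omega)).1 hγ
    obtain ⟨i, hi, hdvd⟩ := exists_odd_mul_gcd_dvd_pow_add_one (q := q) hn hrq
      fun he => (h he).trans hγv
    -- In K this number equals 1, so primitive (q^i + 1)-th roots of unity exist; δ is sought among
    -- their powers.
    have hNK : ((q ^ i + 1 : ℕ) : K) ≠ 0 := by
      have hpK : (p : K) = 0 := CharP.cast_eq_zero K p
      rw [hq]
      push_cast
      rw [hpK, zero_pow hm, zero_pow hi.pos.ne', zero_add]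
      exact one_ne_zero
    have : NeZero ((q ^ i + 1 : ℕ) : K) := ⟨hNK⟩
    obtain ⟨ζ, hζ⟩ := HasEnoughRootsOfUnity.exists_primitiveRoot K (q ^ i + 1)
    obtain ⟨δ, hδN, hδn⟩ := exists_pow_eq_of_mul_gcd_dvd (n := n) (by omega) hζ hr0
      (by rw [← hrK, pow_orderOf_eq_one] : (algebraMap F K c) ^ r = 1) hdvd
    have hδ0 := hne hδn
    have hint : IsIntegral F δ := Algebra.IsIntegral.isIntegral δ
    have hirr := minpoly.irreducible hint
    have hmon := minpoly.monic hint
    have hfd : minpoly F δ ∣ X ^ n - C c := minpoly.dvd _ _ (by simp [hδn])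
    have h0 := coeff_zero_ne_zero_of_dvd_X_pow_sub_C hn hc0 hfd
    refine ⟨minpoly F δ, hirr, hmon, hfd, ?_⟩
    have h1 := aeval_conjReciprocal_eq_zero hq hσ hδ0 (minpoly.aeval F δ)
    have h2 := minpoly.eq_of_irreducible_of_monic (irreducible_conjReciprocal hσ hσσ hmon h0 hirr)
      h1 (monic_conjReciprocal hσ h0)
    rw [h2]
    refine (minpoly.eq_of_irreducible_of_monic hirr ?_ hmon).symm
    obtain ⟨k, hk⟩ := hi.add_one
    -- From δ^(q^i + 1) = 1 and i + 1 = 2k: δ^(-q) is a conjugate of δ over F, so it is a root of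
    -- the minimal polynomial of δ as well.
    have h3 : (δ ^ q)⁻¹ = δ ^ Nat.card F ^ k := by
      rw [hF, ← pow_mul, two_mul, ← hk, inv_eq_of_mul_eq_one_right]
      rw [← pow_add, show q + q ^ (i + 1) = (q ^ i + 1) * q by ring, pow_mul, hδN, one_pow]
    have := Fintype.ofFinite F
    have h4 := congrFun (FiniteField.coe_frobeniusAlgEquivOfAlgebraic_iterate F K k) δ
    rw [h3, Nat.card_eq_fintype_card, ← h4, ← AlgEquiv.coe_pow]
    rw [aeval_algHom_apply, minpoly.aeval, map_zero]

end Roots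

/-! ### Constacyclic codes as ideals modulo x^n - λ. -/

section Codes

variable {F : Type*} [Field F] {n : ℕ}

/-- The polynomial `∑ i, v i * X ^ i` of a vector `v`. -/
def toPoly : (Fin n → F) →ₗ[F] F[X] :=
  (degreeLT F n).subtype ∘ₗ (degreeLTEquiv F n).symm.toLinearMap

theorem toPoly_eq_sum (v : Fin n → F) : toPoly v = ∑ i : Fin n, C (v i) * X ^ (i : ℕ) := by
  simp only [C_mul_X_pow_eq_monomial]
  rfl

theorem degree_toPoly_lt (v : Fin n → F) : (toPoly v).degree < n :=
  mem_degreeLT.1 ((degreeLTEquiv F n).symm v).2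

theorem coeff_toPoly (v : Fin n → F) (i : Fin n) : (toPoly v).coeff i = v i :=
  congrFun ((degreeLTEquiv F n).apply_symm_apply v) i

theorem coeff_toPoly_of_le (v : Fin n → F) {k : ℕ} (hk : n ≤ k) : (toPoly v).coeff k = 0 :=
  coeff_eq_zero_of_degree_lt ((degree_toPoly_lt v).trans_le (by exact_mod_cast hk))

theorem toPoly_coeff {p : F[X]} (hp : p.degree < n) : toPoly (fun i : Fin n => p.coeff i) = p := by
  ext k
  rcases lt_or_ge k n with hk | hk
  · exact coeff_toPoly _ ⟨k, hk⟩
  · rw [coeff_toPoly_of_le _ hk,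
      coeff_eq_zero_of_degree_lt (hp.trans_le (by exact_mod_cast hk))]

/-- The code of all vectors whose polynomial is divisible by `g`. -/
def polyCode (n : ℕ) (g : F[X]) : Submodule F (Fin n → F) :=
  ((Ideal.span {g}).restrictScalars F).comap toPoly

theorem mem_polyCode {g : F[X]} {v : Fin n → F} : v ∈ polyCode n g ↔ g ∣ toPoly v := by
  simp [polyCode, Ideal.mem_span_singleton]

theorem finrank_polyCode {g : F[X]} (hg : g ≠ 0) :
    Module.finrank F (polyCode n g) = n - g.natDegree := by
  let L : degreeLT F (n - g.natDegree) →ₗ[F] (Fin n → F) :=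
    (LinearMap.pi fun i : Fin n => lcoeff F i) ∘ₗ LinearMap.mulLeft F g ∘ₗ
      (degreeLT F (n - g.natDegree)).subtype
  have hL : ∀ w i, L w i = (g * (w : F[X])).coeff i := fun w i => rfl
  have hdeg : ∀ w : degreeLT F (n - g.natDegree), (g * (w : F[X])).degree < n := by
    intro w
    by_cases hw : (w : F[X]) = 0
    · rw [hw, mul_zero, degree_zero]; exact WithBot.bot_lt_coe n
    · have h := mem_degreeLT.1 w.2
      rw [degree_eq_natDegree hw, Nat.cast_lt] at h
      rw [degree_eq_natDegree (mul_ne_zero hg hw), natDegree_mul hg hw, Nat.cast_lt]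
      omega
  have hLp : ∀ w, toPoly (L w) = g * (w : F[X]) := fun w => toPoly_coeff (hdeg w)
  have hinj : Function.Injective L := by
    intro a b hab
    have h := congrArg toPoly hab
    rw [hLp, hLp] at h
    exact Subtype.ext (mul_left_cancel₀ hg h)
  have hrange : polyCode n g = LinearMap.range L := by
    ext v
    rw [mem_polyCode, LinearMap.mem_range]
    constructor
    · rintro ⟨w, hw⟩
      have hwd : w ∈ degreeLT F (n - g.natDegree) := by
        rw [mem_degreeLT]
        by_cases hw0 : w = 0
        · rw [hw0, degree_zero]; exact WithBot.bot_lt_coe _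
        · have h := degree_toPoly_lt v
          rw [hw, degree_eq_natDegree (mul_ne_zero hg hw0), natDegree_mul hg hw0,
            Nat.cast_lt] at h
          rw [degree_eq_natDegree hw0, Nat.cast_lt]
          omega
      refine ⟨⟨w, hwd⟩, ?_⟩
      ext i
      rw [hL, ← coeff_toPoly v i, hw]
    · rintro ⟨w, rfl⟩
      rw [hLp]
      exact dvd_mul_right _ _
  rw [hrange, LinearMap.finrank_range_of_inj hinj, (degreeLTEquiv F _).finrank_eq,
    Module.finrank_fin_fun]

variable {lam : F}

theorem constaShift_injective (h0 : lam ≠ 0) :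
    Function.Injective (constaShift lam : (Fin n → F) → Fin n → F) := by
  intro u v h
  ext ⟨i, hi⟩
  rcases Nat.lt_or_ge (i + 1) n with h1 | h1
  · simpa [constaShift] using congrFun h ⟨i + 1, h1⟩
  · have h2 : i = n - 1 := by omega
    subst h2
    simpa [constaShift, h0] using congrFun h ⟨0, by omega⟩

theorem toPoly_constaShift (hn : n ≠ 0) (v : Fin n → F) :
    toPoly (constaShift lam v) =
      X * toPoly v - C (v ⟨n - 1, by omega⟩) * (X ^ n - C lam) := by
  ext k
  rcases lt_or_ge k n with hk | hk
  · rw [show (toPoly (constaShift lam v)).coeff k = constaShift lam v ⟨k, hk⟩ from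
      coeff_toPoly _ ⟨k, hk⟩]
    cases k with
    | zero => simp [constaShift, hn.symm, mul_comm]
    | succ k =>
      have h : (toPoly v).coeff k = v ⟨k, by omega⟩ := coeff_toPoly v ⟨k, by omega⟩
      simp [constaShift, coeff_X_mul, h, coeff_X_pow, coeff_C_succ, hk.ne]
  · rw [coeff_toPoly_of_le _ hk]
    obtain ⟨k, rfl⟩ : ∃ l, k = l + 1 := ⟨k - 1, by omega⟩
    rcases hk.eq_or_lt with h1 | h1
    · have h : (toPoly v).coeff k = v ⟨n - 1, by omega⟩ := by
        have : k = n - 1 := by omega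
        subst this
        exact coeff_toPoly v ⟨_, _⟩
      simp [coeff_X_mul, h, coeff_X_pow, coeff_C_succ, h1]
    · simp [coeff_X_mul, coeff_toPoly_of_le v (show n ≤ k by omega), coeff_X_pow, coeff_C_succ,
        h1.ne']

theorem dvd_toPoly_constaShift_iterate (hn : n ≠ 0) (v : Fin n → F) (j : ℕ) :
    X ^ n - C lam ∣ X ^ j * toPoly v - toPoly ((constaShift lam)^[j] v) := by
  induction j with
  | zero => simp
  | succ j ih =>
    rw [Function.iterate_succ_apply', toPoly_constaShift hn]
    obtain ⟨w, hw⟩ := ih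
    refine ⟨X * w + C ((constaShift lam)^[j] v ⟨n - 1, by omega⟩), ?_⟩
    rw [mul_add, ← mul_left_comm, ← hw]
    ring

theorem polyCode_mem_constacyclicCodes (hn : n ≠ 0) {g : F[X]} (hg : g ∣ X ^ n - C lam) :
    polyCode n g ∈ constacyclicCodes n lam := by
  intro c hc
  rw [mem_polyCode] at hc ⊢
  rw [toPoly_constaShift hn]
  exact dvd_sub (hc.mul_left _) (hg.mul_left _)

/-- Reduction modulo `X ^ n - lam`, as a vector of coefficients. -/
def reduceVec (n : ℕ) (lam : F) : F[X] →ₗ[F] (Fin n → F) :=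
  (LinearMap.pi fun i : Fin n => lcoeff F i) ∘ₗ (modByMonicHom (X ^ n - C lam))

theorem toPoly_reduceVec (hn : n ≠ 0) (p : F[X]) :
    toPoly (reduceVec n lam p) = p %ₘ (X ^ n - C lam) :=
  toPoly_coeff (by
    have h := degree_modByMonic_lt p (monic_X_pow_sub_C lam hn)
    rwa [degree_X_pow_sub_C (Nat.pos_of_ne_zero hn)] at h)

theorem reduceVec_toPoly (hn : n ≠ 0) (v : Fin n → F) : reduceVec n lam (toPoly v) = v := by
  ext i
  change (toPoly v %ₘ (X ^ n - C lam)).coeff i = v i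
  rw [(modByMonic_eq_self_iff (monic_X_pow_sub_C lam hn)).2, coeff_toPoly]
  rw [degree_X_pow_sub_C (Nat.pos_of_ne_zero hn)]
  exact degree_toPoly_lt v

theorem reduceVec_eq_zero_iff (hn : n ≠ 0) {p : F[X]} :
    reduceVec n lam p = 0 ↔ X ^ n - C lam ∣ p := by
  rw [← modByMonic_eq_zero_iff_dvd (monic_X_pow_sub_C lam hn), ← toPoly_reduceVec hn]
  constructor
  · intro h; rw [h, map_zero]
  · intro h
    rw [← reduceVec_toPoly (lam := lam) hn (reduceVec n lam p), h, map_zero]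

theorem reduceVec_eq_of_dvd (hn : n ≠ 0) {p p' : F[X]} (h : X ^ n - C lam ∣ p - p') :
    reduceVec n lam p = reduceVec n lam p' := by
  rw [← sub_eq_zero, ← map_sub, reduceVec_eq_zero_iff hn]
  exact h

theorem dvd_sub_toPoly_reduceVec (hn : n ≠ 0) (p : F[X]) :
    X ^ n - C lam ∣ p - toPoly (reduceVec n lam p) := by
  rw [toPoly_reduceVec hn]
  exact ⟨p /ₘ (X ^ n - C lam), by linear_combination -modByMonic_add_div p (X ^ n - C lam)⟩

theorem reduceVec_X_mul (hn : n ≠ 0) (p : F[X]) :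
    reduceVec n lam (X * p) = constaShift lam (reduceVec n lam p) := by
  rw [← reduceVec_toPoly (lam := lam) hn (constaShift lam _)]
  apply reduceVec_eq_of_dvd hn
  rw [toPoly_constaShift hn]
  obtain ⟨w, hw⟩ := dvd_sub_toPoly_reduceVec (lam := lam) hn p
  refine ⟨X * w + C (reduceVec n lam p ⟨n - 1, by omega⟩), ?_⟩
  rw [mul_add, ← mul_left_comm, ← hw]
  ring

/-- The shift is multiplication by X modulo X^n - λ, so the preimage of the code in F[X] is an
ideal, and its generator divides X^n - λ. -/
theorem exists_polyCode_eq (hn : n ≠ 0) {C₀ : Submodule F (Fin n → F)}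
    (hC : C₀ ∈ constacyclicCodes n lam) :
    ∃ g : F[X], g.Monic ∧ g ∣ X ^ n - C lam ∧ polyCode n g = C₀ := by
  classical
  let I : Ideal F[X] :=
    { C₀.comap (reduceVec n lam) with
      smul_mem' := by
        intro c p hp
        change reduceVec n lam (c * p) ∈ C₀
        replace hp : reduceVec n lam p ∈ C₀ := hp
        induction c using Polynomial.induction_on' with
        | add a b ha hb => rw [add_mul, map_add]; exact C₀.add_mem ha hb
        | monomial k a =>
          induction k with
          | zero =>
            rw [monomial_zero_left, ← smul_eq_C_mul, map_smul]
            exact C₀.smul_mem a hp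
          | succ k ih =>
            rw [← X_mul_monomial, mul_assoc, reduceVec_X_mul hn]
            exact hC _ ih }
  have hI : ∀ p, p ∈ I ↔ reduceVec n lam p ∈ C₀ := fun p => Iff.rfl
  obtain ⟨g, hg⟩ := (IsPrincipalIdealRing.principal I).principal
  have hgI : ∀ p, g ∣ p ↔ p ∈ I := fun p => by
    rw [hg]; exact Ideal.mem_span_singleton.symm
  have hgN : g ∣ X ^ n - C lam := by
    rw [hgI, hI, (reduceVec_eq_zero_iff hn).2 dvd_rfl]
    exact C₀.zero_mem
  have hg0 : g ≠ 0 := by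
    rintro rfl
    exact (monic_X_pow_sub_C lam hn).ne_zero (zero_dvd_iff.1 hgN)
  refine ⟨normalize g, monic_normalize hg0, normalize_dvd_iff.2 hgN, ?_⟩
  ext v
  rw [mem_polyCode, normalize_dvd_iff, hgI, hI, reduceVec_toPoly hn]

theorem natDegree_le_of_dvd_X_pow_sub_C (hn : n ≠ 0) {g : F[X]} (hg : g ∣ X ^ n - C lam) :
    g.natDegree ≤ n := by
  simpa using natDegree_le_of_dvd hg (monic_X_pow_sub_C lam hn).ne_zero

theorem eq_X_pow_sub_C_of_natDegree_eq (hn : n ≠ 0) {g : F[X]} (hgm : g.Monic)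
    (hg : g ∣ X ^ n - C lam) (hd : g.natDegree = n) : g = X ^ n - C lam :=
  (eq_of_monic_of_dvd_of_natDegree_le hgm (monic_X_pow_sub_C lam hn) hg (by simp [hd])).symm

theorem eq_of_polyCode_eq (hn : n ≠ 0) {g h : F[X]} (hgm : g.Monic) (hhm : h.Monic)
    (hg : g ∣ X ^ n - C lam) (hh : h ∣ X ^ n - C lam) (heq : polyCode n g = polyCode n h) :
    g = h := by
  have hd : g.natDegree = h.natDegree := by
    have h1 := finrank_polyCode (n := n) hgm.ne_zero
    rw [heq, finrank_polyCode hhm.ne_zero] at h1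
    have h2 := natDegree_le_of_dvd_X_pow_sub_C hn hg
    have h3 := natDegree_le_of_dvd_X_pow_sub_C hn hh
    omega
  -- In degree n (the zero code) g is not the polynomial of a vector; below n it is itself a
  -- codeword.
  rcases (natDegree_le_of_dvd_X_pow_sub_C hn hg).eq_or_lt with h1 | h1
  · rw [eq_X_pow_sub_C_of_natDegree_eq hn hgm hg h1,
      eq_X_pow_sub_C_of_natDegree_eq hn hhm hh (hd ▸ h1)]
  · have h2 : toPoly (fun i : Fin n => g.coeff i) = g :=
      toPoly_coeff (by rw [degree_eq_natDegree hgm.ne_zero]; exact_mod_cast h1)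
    have h3 : (fun i : Fin n => g.coeff i) ∈ polyCode n g := by rw [mem_polyCode, h2]
    rw [heq, mem_polyCode, h2] at h3
    exact eq_of_monic_of_dvd_of_natDegree_le hhm hgm h3 hd.le

end Codes

/-! ### The Hermitian dual through polynomial multiplication. -/

section Dual

variable {F : Type*} [Field F] {n q : ℕ} {lam : F} {σ : F →+* F}

/-- Only the wrapped coordinate acquires a factor, namely λ · λ^q = 1. -/
theorem sum_constaShift_mul (hlam : lam ^ (q + 1) = 1) (u v : Fin n → F) :
    ∑ i, constaShift lam u i * constaShift lam v i ^ q = ∑ i, u i * v i ^ q := by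
  cases n with
  | zero => simp
  | succ n =>
    rw [Fin.sum_univ_succ, Fin.sum_univ_castSucc, add_comm]
    congr 1
    simp only [constaShift, Fin.val_zero, if_true, mul_pow, Nat.add_sub_cancel]
    change lam * u (Fin.last n) * (lam ^ q * v (Fin.last n) ^ q) = _
    rw [mul_mul_mul_comm, ← pow_succ', hlam, one_mul]

theorem sum_constaShift_iterate_mul (hlam : lam ^ (q + 1) = 1) (u v : Fin n → F) (j : ℕ) :
    ∑ i, (constaShift lam)^[j] u i * (constaShift lam)^[j] v i ^ q = ∑ i, u i * v i ^ q := by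
  induction j with
  | zero => rfl
  | succ j ih => simp only [Function.iterate_succ_apply', sum_constaShift_mul hlam, ih]

theorem exists_constaShift_iterate_eq [Finite F] (h0 : lam ≠ 0) {C₀ : Submodule F (Fin n → F)}
    (hC : C₀ ∈ constacyclicCodes n lam) (j : ℕ) {v : Fin n → F} (hv : v ∈ C₀) :
    ∃ w ∈ C₀, (constaShift lam)^[j] w = v := by
  let T : C₀ → C₀ := fun c => ⟨constaShift lam c, hC c c.2⟩
  have hT : Function.Injective T := fun a b hab =>
    Subtype.ext (constaShift_injective h0 (congrArg Subtype.val hab))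
  induction j generalizing v with
  | zero => exact ⟨v, hv, rfl⟩
  | succ j ih =>
    obtain ⟨w, hw⟩ := Finite.injective_iff_surjective.1 hT ⟨v, hv⟩
    obtain ⟨x, hx, hxw⟩ := ih w.2
    exact ⟨x, hx, by rw [Function.iterate_succ_apply', hxw]; exact congrArg Subtype.val hw⟩

theorem coeff_zero_X_pow_modByMonic {i j : ℕ} (hi : i < n) (hj : j < n) :
    ((X ^ (j + (n - i)) : F[X]) %ₘ (X ^ n - C lam)).coeff 0 = if i = j then lam else 0 := by
  have hn : n ≠ 0 := by omega
  have hmon := monic_X_pow_sub_C lam hn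
  have hdeg : ∀ (c : F) {k : ℕ}, k < n → (C c * X ^ k : F[X]).degree < (X ^ n - C lam).degree := by
    intro c k hk
    rw [degree_X_pow_sub_C (by omega)]
    exact (degree_C_mul_X_pow_le k c).trans_lt (by exact_mod_cast hk)
  rcases lt_or_ge j i with h | h
  · have h1 := hdeg 1 (show j + (n - i) < n by omega)
    rw [C_1, one_mul] at h1
    rw [(modByMonic_eq_self_iff hmon).2 h1, coeff_X_pow, if_neg (by omega), if_neg (by omega)]
  · have h1 : (X ^ (j + (n - i)) : F[X]) = C lam * X ^ (j - i) + (X ^ n - C lam) * X ^ (j - i) := by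
      rw [show j + (n - i) = n + (j - i) by omega, pow_add]; ring
    rw [h1, add_modByMonic, (modByMonic_eq_self_iff hmon).2 (hdeg lam (by omega)),
      (modByMonic_eq_zero_iff_dvd hmon).2 (dvd_mul_right _ _), add_zero, coeff_C_mul, coeff_X_pow]
    by_cases hij : i = j
    · simp [hij]
    · rw [if_neg (by omega), if_neg hij, mul_zero]

/-- The Hermitian form as a coefficient of a product of polynomials. -/
theorem lam_mul_sum_eq (hn : n ≠ 0) (hσ : ∀ x, σ x = x ^ q) (u v : Fin n → F) :
    lam * ∑ i, u i * v i ^ q =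
      reduceVec n lam (toPoly u * ((toPoly v).map σ).reflect n) ⟨0, by omega⟩ := by
  -- Reflecting at n rather than n - 1 sends the diagonal terms to X^n, which reduces to λ;
  -- off-diagonal terms have no constant coefficient after reduction.
  have hv : ((toPoly v).map σ).reflect n = ∑ i : Fin n, C (v i ^ q) * X ^ (n - (i : ℕ)) := by
    have hsum := map_sum (AddMonoidHom.mk' (reflect n) (fun a b : F[X] => reflect_add a b n))
      (fun i : Fin n => C (v i ^ q) * X ^ (i : ℕ)) Finset.univ
    simp only [AddMonoidHom.mk'_apply] at hsum
    rw [toPoly_eq_sum, Polynomial.map_sum]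
    simp only [Polynomial.map_mul, map_C, Polynomial.map_pow, map_X, hσ]
    rw [hsum]
    refine Finset.sum_congr rfl fun i _ => ?_
    rw [reflect_C_mul_X_pow, revAt_le i.2.le]
  have hterm : ∀ i j : Fin n, reduceVec n lam
      (C (u j) * X ^ (j : ℕ) * (C (v i ^ q) * X ^ (n - (i : ℕ)))) ⟨0, by omega⟩ =
      if i = j then lam * (u j * v i ^ q) else 0 := by
    intro i j
    have h : (C (u j) * X ^ (j : ℕ) * (C (v i ^ q) * X ^ (n - (i : ℕ))) : F[X]) =
        (u j * v i ^ q) • X ^ ((j : ℕ) + (n - i)) := by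
      rw [smul_eq_C_mul, C_mul, pow_add]; ring
    rw [h, map_smul, Pi.smul_apply, smul_eq_mul]
    have h2 := coeff_zero_X_pow_modByMonic (lam := lam) i.2 j.2
    change _ * ((X ^ ((j : ℕ) + (n - i)) : F[X]) %ₘ (X ^ n - C lam)).coeff 0 = _
    rw [h2]
    by_cases hij : i = j
    · simp [hij, mul_comm]
    · rw [if_neg (fun h => hij (Fin.ext h)), if_neg hij, mul_zero]
  rw [hv, toPoly_eq_sum, Finset.sum_mul_sum]
  simp only [map_sum, Finset.sum_apply, hterm, Finset.sum_ite_eq', Finset.mem_univ, if_true,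
    Finset.mul_sum]

theorem dvd_of_forall_reduceVec_eq_zero (hn : n ≠ 0) (h0 : lam ≠ 0) {w : F[X]}
    (h : ∀ j, reduceVec n lam (w * X ^ j) ⟨0, by omega⟩ = 0) : X ^ n - C lam ∣ w := by
  rw [← reduceVec_eq_zero_iff hn]
  ext i
  -- With q = 1 the form is bilinear, and pairing with a unit vector reads off the i-th coefficient.
  have h1 := lam_mul_sum_eq (q := 1) (σ := RingHom.id F) (lam := lam) hn (by simp)
    (reduceVec n lam w) (Pi.single i 1)
  have h2 : toPoly (Pi.single i 1 : Fin n → F) = X ^ (i : ℕ) := by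
    rw [toPoly_eq_sum, Finset.sum_eq_single i]
    · simp
    · intro j _ hj; simp [hj]
    · simp
  have h3 : X ^ n - C lam ∣
      w * X ^ (n - (i : ℕ)) - toPoly (reduceVec n lam w) * X ^ (n - (i : ℕ)) := by
    rw [← sub_mul]
    exact (dvd_sub_toPoly_reduceVec hn w).mul_right _
  rw [h2, Polynomial.map_id, reflect_monomial, revAt_le i.2.le, ← reduceVec_eq_of_dvd hn h3,
    h] at h1
  simpa [h0, Pi.single_apply] using h1

theorem mem_hermitianDual_polyCode [Finite F] (hn : n ≠ 0) (hσ : ∀ x, σ x = x ^ q)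
    (hlam : lam ^ (q + 1) = 1) {g : F[X]} (hgm : g.Monic) (hg : g ∣ X ^ n - C lam)
    {u : Fin n → F} :
    u ∈ hermitianDual q (polyCode n g) ↔ X ^ n - C lam ∣ toPoly u * conjReciprocal q g := by
  have h0 : lam ≠ 0 := by rintro rfl; simp at hlam
  have hg0 := coeff_zero_ne_zero_of_dvd_X_pow_sub_C hn h0 hg
  have hgn := natDegree_le_of_dvd_X_pow_sub_C hn hg
  have hrev : ∀ b : F[X], b.natDegree ≤ n - g.natDegree → ((g * b).map σ).reflect n =
      C (σ (g.coeff 0)) * conjReciprocal q g * (b.map σ).reflect (n - g.natDegree) := by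
    intro b hb
    conv_lhs => rw [Polynomial.map_mul, ← Nat.add_sub_cancel' hgn]
    rw [reflect_mul _ _ (by simp) (by simpa using hb), conjReciprocal_eq hσ, reverse,
      natDegree_map, ← mul_assoc, ← C_mul, mul_inv_cancel₀ (by simpa using hg0), C_1, one_mul]
  constructor
  · intro hu
    rcases hgn.eq_or_lt with hd | hd
    · rw [eq_X_pow_sub_C_of_natDegree_eq hn hgm hg hd, conjReciprocal_X_pow_sub_C hσ hn hlam]
      exact dvd_mul_left _ _
    · let v : Fin n → F := fun i => g.coeff i
      have hv : toPoly v = g :=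
        toPoly_coeff (by rw [degree_eq_natDegree hgm.ne_zero]; exact_mod_cast hd)
      have hvC : v ∈ polyCode n g := by rw [mem_polyCode, hv]
      -- Every shift of u is still orthogonal to v, since v is a shift of a codeword and shifting
      -- preserves the form. This kills all the coefficients of the product.
      have key : X ^ n - C lam ∣ toPoly u * ((toPoly v).map σ).reflect n := by
        refine dvd_of_forall_reduceVec_eq_zero hn h0 fun j => ?_
        obtain ⟨w, hw, hwv⟩ :=
          exists_constaShift_iterate_eq h0 (polyCode_mem_constacyclicCodes hn hg) j hvC
        have h1 := lam_mul_sum_eq (lam := lam) hn hσ ((constaShift lam)^[j] u) v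
        rw [← hwv, sum_constaShift_iterate_mul hlam, hu w hw, mul_zero, hwv] at h1
        rw [h1]
        refine congrFun (reduceVec_eq_of_dvd hn ?_) _
        obtain ⟨z, hz⟩ := dvd_toPoly_constaShift_iterate (lam := lam) hn u j
        refine ⟨z * ((toPoly v).map σ).reflect n, ?_⟩
        rw [← mul_assoc, ← hz]
        ring
      -- The reflection of g at n is a unit times g† times this power of X, which can be cancelled.
      have hcop : IsCoprime (X ^ n - C lam : F[X]) (X ^ (n - g.natDegree)) := by
        refine IsCoprime.pow_right ?_
        refine (irreducible_X.coprime_iff_not_dvd.2 ?_).symm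
        rw [X_dvd_iff]
        simp [hn.symm, h0]
      have h2 := hrev 1 (by simp)
      rw [mul_one] at h2
      rw [hv, h2, Polynomial.map_one, reflect_one] at key
      have h3 : toPoly u * (C (σ (g.coeff 0)) * conjReciprocal q g * X ^ (n - g.natDegree)) =
        C (σ (g.coeff 0)) * (toPoly u * conjReciprocal q g * X ^ (n - g.natDegree)) := by ring
      rw [h3] at key
      have hunit : IsUnit (C (σ (g.coeff 0)) : F[X]) := by
        rw [isUnit_C]; simpa using hg0
      exact hcop.dvd_of_dvd_mul_right (hunit.dvd_mul_left.1 key)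
  · intro hu v hv
    rw [mem_polyCode] at hv
    obtain ⟨b, hb⟩ := hv
    have hbd : b.natDegree ≤ n - g.natDegree := by
      by_cases hb0 : b = 0
      · simp [hb0]
      · have h := degree_toPoly_lt v
        rw [hb, degree_eq_natDegree (mul_ne_zero hgm.ne_zero hb0),
          natDegree_mul hgm.ne_zero hb0, Nat.cast_lt] at h
        omega
    have h1 := lam_mul_sum_eq (lam := lam) hn hσ u v
    rw [hb, hrev b hbd, (reduceVec_eq_zero_iff hn).2, Pi.zero_apply] at h1
    · exact (mul_eq_zero.1 h1).resolve_left h0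
    · obtain ⟨z, hz⟩ := hu
      refine ⟨C (σ (g.coeff 0)) * (b.map σ).reflect (n - g.natDegree) * z, ?_⟩
      linear_combination (C (σ (g.coeff 0)) * (b.map σ).reflect (n - g.natDegree)) * hz

end Dual

/-! ### Exponent vectors, hull dimensions and their average. -/

section Parametrization

variable {F : Type*} [Field F] {ι : Type*} {f : ι → F[X]}

theorem pairwise_isCoprime (hirr : ∀ i, Irreducible (f i)) (hmon : ∀ i, (f i).Monic)
    (hinj : Function.Injective f) : Pairwise fun i j => IsCoprime (f i) (f j) := by
  intro i j hij
  refine (hirr i).coprime_iff_not_dvd.2 fun h => hij (hinj ?_)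
  exact eq_of_monic_of_associated (hmon i) (hmon j) ((hirr i).associated_of_dvd (hirr j) h)

theorem exists_associated_prod_pow (hirr : ∀ i, Irreducible (f i)) {P : ℕ} (s : Finset ι)
    {g : F[X]} (hg : g ∣ ∏ i ∈ s, f i ^ P) :
    ∃ a : ι → ℕ, (∀ i, a i ≤ P) ∧ Associated g (∏ i ∈ s, f i ^ a i) := by
  classical
  induction s using Finset.induction_on generalizing g with
  | empty =>
    refine ⟨fun _ => 0, fun _ => Nat.zero_le _, ?_⟩
    simp only [Finset.prod_empty] at hg ⊢
    exact associated_one_iff_isUnit.2 (isUnit_of_dvd_one hg)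
  | insert i s hi ih =>
    rw [Finset.prod_insert hi] at hg
    obtain ⟨g₁, g₂, h₁, h₂, rfl⟩ := exists_dvd_and_dvd_of_dvd_mul hg
    obtain ⟨k, hk, hk'⟩ := (dvd_prime_pow (hirr i).prime P).1 h₁
    obtain ⟨a, ha, ha'⟩ := ih h₂
    refine ⟨Function.update a i k, fun j => ?_, ?_⟩
    · by_cases hj : j = i
      · subst hj; simpa using hk
      · simpa [hj] using ha j
    · rw [Finset.prod_insert hi, Function.update_self]
      have : ∏ j ∈ s, f j ^ Function.update a i k j = ∏ j ∈ s, f j ^ a j :=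
        Finset.prod_congr rfl fun j hj => by
          rw [Function.update_of_ne (ne_of_mem_of_not_mem hj hi)]
      rw [this]
      exact hk'.mul_mul ha'

variable [Fintype ι]

theorem prod_pow_dvd_iff (hirr : ∀ i, Irreducible (f i)) (hmon : ∀ i, (f i).Monic)
    (hinj : Function.Injective f) (a : ι → ℕ) (x : F[X]) :
    ∏ i, f i ^ a i ∣ x ↔ ∀ i, f i ^ a i ∣ x := by
  refine ⟨fun h i => (Finset.dvd_prod_of_mem (fun i => f i ^ a i) (Finset.mem_univ i)).trans h,
    fun h => Fintype.prod_dvd_of_coprime (fun i j hij => ?_) h⟩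
  exact (pairwise_isCoprime hirr hmon hinj hij).pow

theorem le_of_prod_pow_dvd (hirr : ∀ i, Irreducible (f i)) (hmon : ∀ i, (f i).Monic)
    (hinj : Function.Injective f) {a b : ι → ℕ} (h : ∏ i, f i ^ a i ∣ ∏ i, f i ^ b i) (i : ι) :
    a i ≤ b i := by
  classical
  have h1 := (prod_pow_dvd_iff hirr hmon hinj a _).1 h i
  rw [← Finset.mul_prod_erase _ _ (Finset.mem_univ i)] at h1
  have h2 : IsCoprime (f i ^ a i) (∏ j ∈ Finset.univ.erase i, f j ^ b j) :=
    IsCoprime.prod_right fun j hj =>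
      (pairwise_isCoprime hirr hmon hinj (Finset.ne_of_mem_erase hj).symm).pow
  exact (pow_dvd_pow_iff (hirr i).ne_zero (hirr i).not_isUnit).1 (h2.dvd_of_dvd_mul_right h1)

theorem monic_prod_pow (hmon : ∀ i, (f i).Monic) (a : ι → ℕ) : (∏ i, f i ^ a i).Monic :=
  monic_prod_of_monic _ _ fun i _ => (hmon i).pow _

theorem natDegree_prod_pow (hmon : ∀ i, (f i).Monic) (a : ι → ℕ) :
    (∏ i, f i ^ a i).natDegree = ∑ i, a i * (f i).natDegree := by
  rw [natDegree_prod_of_monic _ _ fun i _ => (hmon i).pow _]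
  simp only [(hmon _).natDegree_pow]

theorem prod_pow_dvd_prod_pow {P : ℕ} {a : ι → ℕ} (ha : ∀ i, a i ≤ P) :
    ∏ i, f i ^ a i ∣ ∏ i, f i ^ P :=
  Finset.prod_dvd_prod_of_dvd _ _ fun i _ => pow_dvd_pow _ (ha i)

variable {n q P : ℕ} {lam : F}

theorem bijOn_polyCode_prod_pow (hn : n ≠ 0) (hirr : ∀ i, Irreducible (f i))
    (hmon : ∀ i, (f i).Monic) (hinj : Function.Injective f)
    (hN : ∏ i, f i ^ P = X ^ n - C lam) :
    Set.BijOn (fun a : ι → Fin (P + 1) => polyCode n (∏ i, f i ^ (a i : ℕ))) Set.univ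
      (constacyclicCodes n lam) := by
  have hdvd : ∀ a : ι → Fin (P + 1), ∏ i, f i ^ (a i : ℕ) ∣ X ^ n - C lam := fun a => by
    rw [← hN]; exact prod_pow_dvd_prod_pow fun i => Nat.lt_succ_iff.1 (a i).2
  refine ⟨fun a _ => polyCode_mem_constacyclicCodes hn (hdvd a), fun a _ b _ hab => ?_, ?_⟩
  · have h := eq_of_polyCode_eq hn (monic_prod_pow hmon _) (monic_prod_pow hmon _) (hdvd a)
      (hdvd b) hab
    ext i
    exact le_antisymm (le_of_prod_pow_dvd hirr hmon hinj h.dvd i)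
      (le_of_prod_pow_dvd hirr hmon hinj h.symm.dvd i)
  · intro C₀ hC₀
    obtain ⟨g, hgm, hg, rfl⟩ := exists_polyCode_eq hn hC₀
    rw [← hN] at hg
    obtain ⟨a, ha, hga⟩ := exists_associated_prod_pow hirr _ hg
    refine ⟨fun i => ⟨a i, Nat.lt_succ_iff.2 (ha i)⟩, Set.mem_univ _, ?_⟩
    exact congrArg (polyCode n)
      (eq_of_monic_of_associated hgm (monic_prod_pow hmon a) hga).symm

variable {σ : F →+* F} {τ : ι → ι}

theorem finrank_hermitianHull_polyCode [Finite F] (hn : n ≠ 0) (hσ : ∀ x, σ x = x ^ q)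
    (hlam : lam ^ (q + 1) = 1) (hirr : ∀ i, Irreducible (f i))
    (hmon : ∀ i, (f i).Monic) (hinj : Function.Injective f)
    (hN : ∏ i, f i ^ P = X ^ n - C lam) (hτ : ∀ i, conjReciprocal q (f i) = f (τ i))
    (hττ : Function.Involutive τ) {a : ι → ℕ} (ha : ∀ i, a i ≤ P) :
    Module.finrank F (hermitianHull q (polyCode n (∏ i, f i ^ a i))) =
      ∑ i, min (P - a i) (a (τ i)) * (f i).natDegree := by
  have hconj : conjReciprocal q (∏ i, f i ^ a i) = ∏ i, f i ^ a (τ i) := by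
    rw [conjReciprocal_prod_pow hσ]
    simp only [hτ]
    refine Fintype.prod_equiv hττ.toPerm _ _ fun i => ?_
    rw [Function.Involutive.coe_toPerm, hττ]
  have hsplit : ∏ i, f i ^ P = (∏ i, f i ^ (P - a (τ i))) * ∏ i, f i ^ a (τ i) := by
    rw [← Finset.prod_mul_distrib]
    refine Finset.prod_congr rfl fun i _ => ?_
    rw [← pow_add, Nat.sub_add_cancel (ha _)]
  have hdvd : ∏ i, f i ^ a i ∣ X ^ n - C lam := by
    rw [← hN]; exact prod_pow_dvd_prod_pow ha
  -- Cancelling g† in N ∣ u g† leaves the condition that each f_i^(P - a_{τ i}) divides u, to be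
  -- combined with f_i^{a_i} ∣ u.
  have hull : hermitianHull q (polyCode n (∏ i, f i ^ a i)) =
      polyCode n (∏ i, f i ^ max (a i) (P - a (τ i))) := by
    ext u
    rw [hermitianHull, Submodule.mem_inf,
      mem_hermitianDual_polyCode hn hσ hlam (monic_prod_pow hmon a) hdvd, hconj, ← hN, hsplit,
      mul_dvd_mul_iff_right (monic_prod_pow hmon _).ne_zero, mem_polyCode, mem_polyCode,
      prod_pow_dvd_iff hirr hmon hinj, prod_pow_dvd_iff hirr hmon hinj,
      prod_pow_dvd_iff hirr hmon hinj, ← forall_and]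
    refine forall_congr' fun i => ?_
    rcases le_total (a i) (P - a (τ i)) with h | h
    · rw [max_eq_right h]
      exact ⟨fun h1 => h1.2, fun h1 => ⟨(pow_dvd_pow _ h).trans h1, h1⟩⟩
    · rw [max_eq_left h]
      exact ⟨fun h1 => h1.1, fun h1 => ⟨h1, (pow_dvd_pow _ h).trans h1⟩⟩
  rw [hull, finrank_polyCode (monic_prod_pow hmon _).ne_zero, natDegree_prod_pow hmon]
  have hdeg := congrArg natDegree hN
  rw [natDegree_prod_pow hmon, natDegree_X_pow_sub_C] at hdeg
  rw [← hdeg, Nat.sub_eq_iff_eq_add, ← Finset.sum_add_distrib]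
  · refine Finset.sum_congr rfl fun i _ => ?_
    rw [← add_mul]
    have := ha i
    have := ha (τ i)
    congr 1
    omega
  · refine Finset.sum_le_sum fun i _ => Nat.mul_le_mul_right _ ?_
    have := ha i
    omega

open Classical in
/-- The average hull dimension in terms of the factorization of `X ^ n - lam`. -/
theorem avgHullDim_eq [Finite F] (hn : n ≠ 0) (hσ : ∀ x, σ x = x ^ q)
    (hlam : lam ^ (q + 1) = 1) (hirr : ∀ i, Irreducible (f i))
    (hmon : ∀ i, (f i).Monic) (hinj : Function.Injective f)
    (hN : ∏ i, f i ^ P = X ^ n - C lam) (hτ : ∀ i, conjReciprocal q (f i) = f (τ i))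
    (hττ : Function.Involutive τ) :
    avgHullDim q n lam = ∑ i, ((f i).natDegree : ℝ) *
      if τ i = i then (∑ x : Fin (P + 1), ((min (P - (x : ℕ)) (x : ℕ) : ℕ) : ℝ)) / (P + 1)
      else (P : ℝ) * (2 * P + 1) / (6 * (P + 1)) := by
  have hbij := bijOn_polyCode_prod_pow hn hirr hmon hinj hN
  have hcard : (constacyclicCodes n lam).ncard = (P + 1) ^ Fintype.card ι := by
    rw [← hbij.image_eq, hbij.injOn.ncard_image, Set.ncard_univ,
      Nat.card_eq_fintype_card, Fintype.card_fun, Fintype.card_fin]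
  have hsum : ∑ C₀ ∈ (Set.toFinite (constacyclicCodes n lam)).toFinset,
      (Module.finrank F (hermitianHull q C₀) : ℝ) =
      ∑ a : ι → Fin (P + 1), ∑ i, ((min (P - (a i : ℕ)) (a (τ i) : ℕ) : ℕ) : ℝ) *
        (f i).natDegree := by
    symm
    refine Finset.sum_nbij (fun a : ι → Fin (P + 1) => polyCode n (∏ i, f i ^ (a i : ℕ)))
      (fun a _ => ?_) ?_ ?_ fun a _ => ?_
    · rw [Set.Finite.mem_toFinset]; exact hbij.mapsTo (Set.mem_univ a)
    · rw [Finset.coe_univ]; exact hbij.injOn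
    · rw [Finset.coe_univ, Set.Finite.coe_toFinset]; exact hbij.surjOn
    · rw [finrank_hermitianHull_polyCode (a := fun i => (a i : ℕ)) hn hσ hlam hirr hmon hinj hN
        hτ hττ fun i => Nat.lt_succ_iff.1 (a i).2]
      push_cast
      rfl
  have hP : (P : ℝ) + 1 ≠ 0 := by positivity
  rw [avgHullDim, ← Finset.sum_div, hsum, hcard, Finset.sum_comm, Finset.sum_div]
  refine Finset.sum_congr rfl fun i _ => ?_
  rw [← Finset.sum_mul, mul_comm, mul_div_assoc]
  congr 1
  push_cast
  rw [div_eq_iff (pow_ne_zero _ hP)]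
  split_ifs with hi
  · have h := sum_pi_apply (K := Fin (P + 1)) i fun x => ((min (P - (x : ℕ)) (x : ℕ) : ℕ) : ℝ)
    rw [Fintype.card_fin] at h
    push_cast at h
    rw [hi, div_mul_eq_mul_div, eq_div_iff hP, h, mul_comm]
  · have h := sum_pi_apply_apply (K := Fin (P + 1)) (i := i) (j := τ i) (fun h => hi h.symm)
      fun x y => ((min (P - (x : ℕ)) (y : ℕ) : ℕ) : ℝ)
    rw [Fintype.card_fin, sum_fin_min_sub] at h
    push_cast at h
    rw [← mul_left_inj' (pow_ne_zero 2 hP), h]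
    field_simp

theorem avgHullDim_eq_iff [Finite F] (hn : n ≠ 0) (hσ : ∀ x, σ x = x ^ q) (hP : P ≠ 0)
    (hlam : lam ^ (q + 1) = 1) (hirr : ∀ i, Irreducible (f i))
    (hmon : ∀ i, (f i).Monic) (hinj : Function.Injective f)
    (hN : ∏ i, f i ^ P = X ^ n - C lam) (hτ : ∀ i, conjReciprocal q (f i) = f (τ i))
    (hττ : Function.Involutive τ) :
    avgHullDim q n lam = (n : ℝ) * (1 / 3 - 1 / (6 * ((P : ℝ) + 1))) ↔ ∀ i, τ i ≠ i := by
  classical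
  rw [avgHullDim_eq hn hσ hlam hirr hmon hinj hN hτ hττ]
  have hdeg := congrArg natDegree hN
  rw [natDegree_prod_pow hmon, natDegree_X_pow_sub_C] at hdeg
  have hP0 : (0 : ℝ) < P := by exact_mod_cast Nat.pos_of_ne_zero hP
  have hrhs : (n : ℝ) * (1 / 3 - 1 / (6 * ((P : ℝ) + 1))) =
      ∑ i, ((f i).natDegree : ℝ) * ((P : ℝ) * (2 * P + 1) / (6 * (P + 1))) := by
    rw [← hdeg, ← Finset.sum_mul, ← Finset.mul_sum]
    push_cast
    field_simp
    ring
  have hlt : (∑ x : Fin (P + 1), ((min (P - (x : ℕ)) (x : ℕ) : ℕ) : ℝ)) / (P + 1) <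
      (P : ℝ) * (2 * P + 1) / (6 * (P + 1)) := by
    have h := sum_fin_min_sub_self_le P
    rw [div_lt_div_iff₀ (by positivity) (by positivity)]
    nlinarith [mul_pos hP0 hP0]
  have hle : ∀ i ∈ Finset.univ, ((f i).natDegree : ℝ) *
      (if τ i = i then (∑ x : Fin (P + 1), ((min (P - (x : ℕ)) (x : ℕ) : ℕ) : ℝ)) / (P + 1)
      else (P : ℝ) * (2 * P + 1) / (6 * (P + 1))) ≤
      ((f i).natDegree : ℝ) * ((P : ℝ) * (2 * P + 1) / (6 * (P + 1))) := fun i _ => by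
    refine mul_le_mul_of_nonneg_left ?_ (Nat.cast_nonneg _)
    split_ifs
    · exact hlt.le
    · exact le_rfl
  -- Termwise inequality: equal sums force equality at each index, which `hlt` excludes at a fixed
  -- point of τ.
  rw [hrhs, Finset.sum_eq_sum_iff_of_le hle]
  refine ⟨fun h i hi => ?_, fun h i _ => by rw [if_neg (h i)]⟩
  have h1 := h i (Finset.mem_univ i)
  rw [if_pos hi] at h1
  have h2 : (0 : ℝ) < (f i).natDegree := by exact_mod_cast (hirr i).natDegree_pos
  exact (mul_lt_mul_of_pos_left hlt h2).ne h1

end Parametrization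

/-! ### From the factorization of x^k - c to the average. -/

section Main

variable {F : Type*} [Field F]

theorem selfConjDegree_eq_zero_iff {q k : ℕ} (hk : k ≠ 0) (c : F) :
    selfConjDegree q k c = 0 ↔
      ¬ ∃ f : F[X], Irreducible f ∧ f.Monic ∧ f ∣ X ^ k - C c ∧ conjReciprocal q f = f := by
  classical
  have hmem : ∀ f : F[X], f ∈ UniqueFactorizationMonoid.normalizedFactors (X ^ k - C c : F[X]) ↔
      Irreducible f ∧ f.Monic ∧ f ∣ X ^ k - C c := fun f =>
    Polynomial.mem_normalizedFactors_iff (monic_X_pow_sub_C c hk).ne_zero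
  rw [selfConjDegree, Multiset.sum_eq_zero_iff]
  simp only [Multiset.mem_map, Multiset.mem_filter]
  constructor
  · rintro h ⟨f, hirr, hmon, hdvd, hf⟩
    exact hirr.natDegree_pos.ne' (h _ ⟨f, ⟨by convert (hmem f).2 ⟨hirr, hmon, hdvd⟩, hf⟩, rfl⟩)
  · rintro h _ ⟨f, ⟨hf, hff⟩, rfl⟩
    have hf' := (hmem f).1 (by convert hf)
    exact absurd ⟨f, hf'.1, hf'.2.1, hf'.2.2, hff⟩ h

theorem avgHullDim_eq_iff_not_exists [Finite F] {p q k ν : ℕ} [Fact p.Prime] [CharP F p]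
    {σ : F →+* F} (hσ : ∀ x, σ x = x ^ q) (hσσ : ∀ x, σ (σ x) = x) (hk : ¬ p ∣ k) {c : F}
    (hc : c ^ (q + 1) = 1) (hk0 : k ≠ 0) :
    avgHullDim q (k * p ^ ν) (c ^ p ^ ν) =
        ((k * p ^ ν : ℕ) : ℝ) * (1 / 3 - 1 / (6 * ((p : ℝ) ^ ν + 1))) ↔
      ¬ ∃ f : F[X], Irreducible f ∧ f.Monic ∧ f ∣ X ^ k - C c ∧ conjReciprocal q f = f := by
  classical
  have hp : p.Prime := Fact.out
  have hpν : p ^ ν ≠ 0 := pow_ne_zero _ hp.ne_zero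
  have hc0 : c ≠ 0 := by rintro rfl; simp at hc
  have hM0 : (X ^ k - C c : F[X]) ≠ 0 := (monic_X_pow_sub_C c hk0).ne_zero
  let S := (UniqueFactorizationMonoid.normalizedFactors (X ^ k - C c : F[X])).toFinset
  have hS : ∀ f, f ∈ S ↔ Irreducible f ∧ f.Monic ∧ f ∣ X ^ k - C c := fun f => by
    rw [Multiset.mem_toFinset]
    exact Polynomial.mem_normalizedFactors_iff hM0
  have hprod : ∏ i : S, (i : F[X]) = X ^ k - C c := by
    have hnd : (UniqueFactorizationMonoid.normalizedFactors (X ^ k - C c : F[X])).Nodup :=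
      (UniqueFactorizationMonoid.squarefree_iff_nodup_normalizedFactors hM0).1
        (separable_X_pow_sub_C' p k c hk hc0).squarefree
    have h := leadingCoeff_mul_prod_normalizedFactors (X ^ k - C c : F[X])
    rw [monic_X_pow_sub_C c hk0, C_1, one_mul] at h
    rw [Finset.prod_coe_sort S fun f => f]
    conv_rhs => rw [← h]
    rw [Finset.prod, Multiset.toFinset_val, hnd.dedup, Multiset.map_id']
  -- Frobenius gives (X^k - c)^(p^ν); the base is squarefree as p ∤ k, so every exponent is exactly
  -- p^ν.
  have hN : ∏ i : S, (i : F[X]) ^ p ^ ν = X ^ (k * p ^ ν) - C (c ^ p ^ ν) := by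
    rw [Finset.prod_pow, hprod, sub_pow_char_pow, ← pow_mul, C_pow]
  have hcoeff : ∀ i : S, (i : F[X]).coeff 0 ≠ 0 := fun i =>
    coeff_zero_ne_zero_of_dvd_X_pow_sub_C hk0 hc0 ((hS i).1 i.2).2.2
  let τ : S → S := fun i => ⟨conjReciprocal q i, by
    obtain ⟨hirr, hmon, g, hg⟩ := (hS i).1 i.2
    refine (hS _).2 ⟨irreducible_conjReciprocal hσ hσσ hmon (hcoeff i) hirr,
      monic_conjReciprocal hσ (hcoeff i), conjReciprocal q g, ?_⟩
    rw [← conjReciprocal_mul hσ, ← hg, conjReciprocal_X_pow_sub_C hσ hk0 hc]⟩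
  have hττ : Function.Involutive τ := fun i => Subtype.ext
    (conjReciprocal_conjReciprocal hσ hσσ ((hS i).1 i.2).2.1 (hcoeff i))
  have h := avgHullDim_eq_iff (P := p ^ ν) (f := fun i : S => (i : F[X])) (τ := τ) (q := q)
    (mul_ne_zero hk0 hpν) hσ hpν (by rw [← pow_mul, mul_comm, pow_mul, hc, one_pow])
    (fun i => ((hS i).1 i.2).1) (fun i => ((hS i).1 i.2).2.1) Subtype.val_injective hN
    (fun i => rfl) hττ
  push_cast at h ⊢
  rw [h]
  constructor
  · rintro h1 ⟨f, hirr, hmon, hdvd, hf⟩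
    exact h1 ⟨f, (hS f).2 ⟨hirr, hmon, hdvd⟩⟩ (Subtype.ext hf)
  · intro h1 i hi
    obtain ⟨hirr, hmon, hdvd⟩ := (hS i).1 i.2
    exact h1 ⟨i, hirr, hmon, hdvd, congrArg Subtype.val hi⟩

end Main

end HermitianHull

end

theorem corollary3 {F : Type*} [Field F] [Finite F] (p q m : ℕ) (hp : p.Prime) (hm : 1 ≤ m)
    (hq : q = p ^ m) (hF : Nat.card F = q ^ 2)
    (n nbar ν : ℕ) (hn : 1 ≤ n) (hnν : n = nbar * p ^ ν) (hnbar : ¬ p ∣ nbar)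
    (lam : F) (r : ℕ) (hr : orderOf lam = r) (hrq : r ∣ q + 1)
    (γ : ℕ) (hγ : 2 ^ γ ∣ q + 1) (hγ' : ¬ 2 ^ (γ + 1) ∣ q + 1) :
    (∀ Lam : F, Lam ^ (p ^ ν) = lam →
      (HermitianHull.avgHullDim q n lam = (n : ℝ) * (1 / 3 - 1 / (6 * ((p : ℝ) ^ ν + 1))) ↔
        HermitianHull.selfConjDegree q nbar Lam = 0)) ∧
    (Even r →
      (HermitianHull.avgHullDim q n lam = (n : ℝ) * (1 / 3 - 1 / (6 * ((p : ℝ) ^ ν + 1))) ↔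
        (padicValNat 2 nbar + padicValNat 2 r > γ ∨ r ∉ HermitianHull.oddGood q))) ∧
    (Odd r →
      (HermitianHull.avgHullDim q n lam = (n : ℝ) * (1 / 3 - 1 / (6 * ((p : ℝ) ^ ν + 1))) ↔
        r ∉ HermitianHull.oddGood q)) := by
  have : Fact p.Prime := ⟨hp⟩
  have : Fintype F := Fintype.ofFinite F
  have : CharP F p := by
    have h1 : Nat.card F = p ^ (m * 2) := by rw [hF, hq, pow_mul]
    rw [Nat.card_eq_fintype_card] at h1
    exact charP_of_card_eq_prime_pow h1
  have : ExpChar F p := ExpChar.prime hp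
  have hσ : ∀ x : F, iterateFrobenius F p m x = x ^ q := fun x => by
    rw [iterateFrobenius_def, hq]
  have hσσ : ∀ x : F, iterateFrobenius F p m (iterateFrobenius F p m x) = x := fun x => by
    rw [hσ, hσ, ← pow_mul, ← pow_two, ← hF, Nat.card_eq_fintype_card, FiniteField.pow_card]
  have hnbar0 : nbar ≠ 0 := by rintro rfl; simp at hnbar
  have hlam : lam ^ (q + 1) = 1 := orderOf_dvd_iff_pow_eq_one.1 (hr ▸ hrq)
  have hfrob : ∀ x : F, iterateFrobenius F p ν x = x ^ p ^ ν := fun x => iterateFrobenius_def p ν x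
  have hinj : Function.Injective (iterateFrobenius F p ν) := RingHom.injective _
  have hroot : ∀ {c : F}, c ^ p ^ ν = lam → c ^ (q + 1) = 1 := fun {c} hc => hinj (by
    rw [hfrob, map_one, ← pow_mul, mul_comm, pow_mul, hc, hlam])
  have hord : ∀ {c : F}, c ^ p ^ ν = lam → orderOf c = r := fun {c} hc => by
    rw [← hr, ← hc, ← hfrob]
    exact (orderOf_injective (iterateFrobenius F p ν).toMonoidHom hinj c).symm
  have hmain : ∀ {c : F}, c ^ p ^ ν = lam →
      (HermitianHull.avgHullDim q n lam = (n : ℝ) * (1 / 3 - 1 / (6 * ((p : ℝ) ^ ν + 1))) ↔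
        ¬ ∃ f : F[X], Irreducible f ∧ f.Monic ∧ f ∣ X ^ nbar - C c ∧
          HermitianHull.conjReciprocal q f = f) :=
    fun {c} hc => by
      have h := HermitianHull.avgHullDim_eq_iff_not_exists (ν := ν) hσ hσσ hnbar (hroot hc) hnbar0
      rw [hc, ← hnν] at h
      exact h
  obtain ⟨c, hc⟩ : ∃ c : F, c ^ p ^ ν = lam := by
    obtain ⟨c, hc⟩ := Finite.injective_iff_surjective.1 hinj lam
    exact ⟨c, by rw [← hfrob, hc]⟩
  have hr1 : 1 ≤ r := Nat.pos_of_ne_zero (by rintro rfl; simp at hrq)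
  -- Since r ∣ q + 1, the exponent 1 already works. So the clause r ∉ M_q is always false: for odd r
  -- the bound is never attained, and for even r only the 2-adic condition remains.
  have hgood : r ∈ HermitianHull.oddGood q := ⟨hr1, 1, odd_one, by rwa [pow_one]⟩
  have hiff := (hmain hc).trans (not_congr (HermitianHull.exists_conjReciprocal_eq_self_iff hq
    (by omega) hF hσ hσσ hnbar0 (hord hc) hrq hγ hγ'))
  refine ⟨fun Lam hLam => ?_, fun he => ?_, fun ho => ?_⟩
  · rw [hmain hLam, HermitianHull.selfConjDegree_eq_zero_iff hnbar0]
  · rw [hiff]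
    simp [he, hgood]
  · rw [hiff]
    simp [hgood, Nat.not_even_iff_odd.2 ho]
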